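/- A context-free grammar $G=(V_N,\Sigma,P,S)$ is an operator grammar if no right-hand side of a rule contains two adjacent nonterminals. For a nonterminal $A$ let $$\mathcal L_G(A)=\{a\in\Sigma \mid A\Rightarrow^* Ba\alpha\},\qquad \mathcal R_G(A)=\{a\in\Sigma \mid A\Rightarrow^* \alpha aB\},$$ where $B$ ranges over $V_N\cup\{\varepsilon\}$ and $\alpha$ over $(V_N\cup\Sigma)^*$. For $a,b\in\Sigma$ put: $a\doteq b$ iff there is a rule $A\to\alpha aBb\beta$ with $B\in V_N\cup\{\varepsilon\}$; $a\gtrdot b$ iff there is a rule $A\to\alpha Db\beta$ with $D\in V_N$ and $a\in\mathcal R_G(D)$; $a\lessdot b$ iff there is a rule $A\to\alpha aD\beta$ with $D\in V_N$ and $b\in\mathcal L_G(D)$. The operator precedence matrix $OPM(G)$ assigns to each pair $(a,b)$ the set of those of the relations $\lessdot,\doteq,\gtrdot$ that hold between $a$ and $b$; a matrix is conflict-free if each entry has at most one element, and two matrices are compatible if their entrywise union is conflict-free. An operator precedence grammar (OPG) is an operator grammar whose matrix is conflict-free, and an operator precedence language (OPL) is a language generated by an OPG. **Corollary.** The inclusion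 problem between OPL with compatible operator precedence matrices is decidable: there is an algorithm (a total computable function) that, given as input any two operator precedence grammars $G_1$ and $G_2$ (finitely described, over arbitrary finite alphabets) such that $OPM(G_1)$ and $OPM(G_2)$ are compatible, decides whether $L(G_1)\subseteq L(G_2)$. -/

import Mathlib

namespace OperatorPrecedence

/-- The three operator precedence relations: `a ⋖ b` (`a` yields precedence to `b`),
`a ≐ b` (equal in precedence), `a ⋗ b` (`a` takes precedence over `b`). -/
inductive PrecRel : Type
  | yields
  | equal
  | takes

/-- An operator precedence matrix over the terminals `T`: each ordered pair of terminals is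
assigned the set of precedence relations holding between them. -/
abbrev PrecMatrix (T : Type*) := T → T → Set PrecRel

/-- A matrix is conflict-free when each of its entries has at most one element. -/
def PrecMatrix.ConflictFree {T : Type*} (M : PrecMatrix T) : Prop :=
  ∀ a b, (M a b).encard ≤ 1

/-- The entrywise union of two matrices. -/
def PrecMatrix.union {T : Type*} (M₁ M₂ : PrecMatrix T) : PrecMatrix T :=
  fun a b => M₁ a b ∪ M₂ a b

/-- Two matrices are compatible when their union is conflict-free. -/
def PrecMatrix.Compatible {T : Type*} (M₁ M₂ : PrecMatrix T) : Prop :=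
  (M₁.union M₂).ConflictFree

/-- The string denoted by an element of `V_N ∪ {ε}`: a single nonterminal, or nothing. -/
def optNonterminal {T N : Type*} : Option N → List (Symbol T N)
  | none => []
  | some B => [Symbol.nonterminal B]

/-- A context-free grammar is an operator grammar when no right-hand side contains two adjacent
nonterminals. -/
def IsOperatorGrammar {T : Type*} (G : ContextFreeGrammar T) : Prop :=
  ∀ r ∈ G.rules, ¬ ∃ (α β : List (Symbol T G.NT)) (A B : G.NT),
    r.output = α ++ [Symbol.nonterminal A, Symbol.nonterminal B] ++ β

/-- The left terminal set `{a | A ⇒* B a α, B ∈ V_N ∪ {ε}}` of the nonterminal `A`. -/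
def leftTerminals {T : Type*} (G : ContextFreeGrammar T) (A : G.NT) : Set T :=
  {a | ∃ (B : Option G.NT) (α : List (Symbol T G.NT)),
    G.Derives [Symbol.nonterminal A] (optNonterminal B ++ [Symbol.terminal a] ++ α)}

/-- The right terminal set `{a | A ⇒* α a B, B ∈ V_N ∪ {ε}}` of the nonterminal `A`. -/
def rightTerminals {T : Type*} (G : ContextFreeGrammar T) (A : G.NT) : Set T :=
  {a | ∃ (α : List (Symbol T G.NT)) (B : Option G.NT),
    G.Derives [Symbol.nonterminal A] (α ++ [Symbol.terminal a] ++ optNonterminal B)}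

/-- `a ≐ b`: some rule has the form `A → α a B b β` with `B ∈ V_N ∪ {ε}`. -/
def EqualPrec {T : Type*} (G : ContextFreeGrammar T) (a b : T) : Prop :=
  ∃ r ∈ G.rules, ∃ (α β : List (Symbol T G.NT)) (B : Option G.NT),
    r.output = α ++ [Symbol.terminal a] ++ optNonterminal B ++ [Symbol.terminal b] ++ β

/-- `a ⋗ b`: some rule has the form `A → α D b β` with `a` in the right terminal set of `D`. -/
def TakesPrec {T : Type*} (G : ContextFreeGrammar T) (a b : T) : Prop :=
  ∃ r ∈ G.rules, ∃ (α β : List (Symbol T G.NT)) (D : G.NT),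
    r.output = α ++ [Symbol.nonterminal D, Symbol.terminal b] ++ β ∧ a ∈ rightTerminals G D

/-- `a ⋖ b`: some rule has the form `A → α a D β` with `b` in the left terminal set of `D`. -/
def YieldsPrec {T : Type*} (G : ContextFreeGrammar T) (a b : T) : Prop :=
  ∃ r ∈ G.rules, ∃ (α β : List (Symbol T G.NT)) (D : G.NT),
    r.output = α ++ [Symbol.terminal a, Symbol.nonterminal D] ++ β ∧ b ∈ leftTerminals G D

/-- The operator precedence matrix of a grammar. -/
def opm {T : Type*} (G : ContextFreeGrammar T) : PrecMatrix T := fun a b =>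
  {ρ | match ρ with
    | PrecRel.yields => YieldsPrec G a b
    | PrecRel.equal => EqualPrec G a b
    | PrecRel.takes => TakesPrec G a b}

/-- An operator precedence grammar: an operator grammar with a conflict-free matrix.
Operator precedence languages are the languages generated by these grammars. -/
def IsOPG {T : Type*} (G : ContextFreeGrammar T) : Prop :=
  IsOperatorGrammar G ∧ (opm G).ConflictFree

/-- A finite description of a context-free grammar, as it is given to an algorithm: the axiom
and the list of the rules, each of them a nonterminal with a right-hand side. Terminals and
nonterminals are both numbered by natural numbers; in a right-hand side, `Sum.inl a` is the
terminal number `a` and `Sum.inr A` is the nonterminal number `A`. -/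
abbrev GrammarCode := ℕ × List (ℕ × List (ℕ ⊕ ℕ))

/-- The symbol denoted by a letter of a right-hand side. -/
def decodeSymbol : ℕ ⊕ ℕ → Symbol ℕ ℕ
  | Sum.inl a => Symbol.terminal a
  | Sum.inr A => Symbol.nonterminal A

/-- The rule denoted by a nonterminal and a right-hand side. -/
def decodeRule (r : ℕ × List (ℕ ⊕ ℕ)) : ContextFreeRule ℕ ℕ where
  input := r.1
  output := r.2.map decodeSymbol

/-- The context-free grammar that a finite description denotes. -/
def GrammarCode.grammar (c : GrammarCode) : ContextFreeGrammar ℕ where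
  NT := ℕ
  initial := c.1
  rules := (c.2.map decodeRule).toFinset

end OperatorPrecedence

/-! Let M be the conflict-free union of the two matrices. Precedence relations alone determine how a
terminal word is bracketed, so two grammars whose matrices lie in M must bracket a common word
consistently. The precise form is `reduces`: suppose a nonterminal A of G₁ derives a nonempty word
w, and G₂ derives x w y from S, where the terminals next to w are related to A as they would be
around A in G₁. Then G₂ derives x B y from S for some nonterminal B deriving w. The induction on
trees of G₁ uses `handle`, by which a chain of ≐ delimited by ⋖ and ⋗ is produced as a single phrase
in G₂.

Hence, inside a tree of G₁, all that matters about the yield of a subtree for G₂ is its type: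
whether it is empty, and the set of nonterminals of G₂ deriving it (`SameType.replace`). The type of
a yield is controlled by the types below it (`exists_sameType_of_output`), and there are finitely
many types, so every type is realised by a tree of bounded height (`exists_sameType_bounded`).
Inclusion therefore needs testing only on the finitely many words of L(G₁) of bounded height.
Membership in L(G₂) is a bounded search as well (`DerivesWithin.of_word_bound`), and the whole test
is primitive recursive. -/

namespace OperatorPrecedence

open Symbol (terminal nonterminal)

/-! ### Derivation trees of bounded height -/

section Derivations

variable {T : Type*} {G : ContextFreeGrammar T}

/-- `DerivesWithin G n s t`: the string `s` derives `t` by replacing each of its symbols by the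
frontier of a derivation tree of height at most `n`. -/
inductive DerivesWithin (G : ContextFreeGrammar T) :
    ℕ → List (Symbol T G.NT) → List (Symbol T G.NT) → Prop
  | nil (n) : DerivesWithin G n [] []
  | keep {n} (X) {s t} : DerivesWithin G n s t → DerivesWithin G n (X :: s) (X :: t)
  | expand {n} (r) {s t u} : r ∈ G.rules → DerivesWithin G n r.output u →
      DerivesWithin G (n + 1) s t → DerivesWithin G (n + 1) (nonterminal r.input :: s) (u ++ t)

theorem DerivesWithin.refl (n : ℕ) : ∀ s, DerivesWithin G n s s
  | [] => .nil n
  | X :: s => .keep X (DerivesWithin.refl n s)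

theorem DerivesWithin.append {n : ℕ} {s t s' t' : List (Symbol T G.NT)}
    (h : DerivesWithin G n s t) (h' : DerivesWithin G n s' t') :
    DerivesWithin G n (s ++ s') (t ++ t') := by
  induction h with
  | nil n => simpa using h'
  | keep X _ ih => exact .keep X (ih h')
  | expand r hr hu _ _ ih =>
    rw [List.append_assoc]
    exact .expand r hr hu (ih h')

theorem DerivesWithin.mono {n m : ℕ} {s t : List (Symbol T G.NT)}
    (h : DerivesWithin G n s t) (hnm : n ≤ m) : DerivesWithin G m s t := by
  induction h generalizing m with
  | nil n => exact .nil m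
  | keep X _ ih => exact .keep X (ih hnm)
  | expand r hr _ _ ihu ih =>
    obtain ⟨m, rfl⟩ : ∃ k, m = k + 1 := ⟨m - 1, by omega⟩
    exact .expand r hr (ihu (by omega)) (ih hnm)

theorem DerivesWithin.eq_nil {n : ℕ} {t : List (Symbol T G.NT)}
    (h : DerivesWithin G n [] t) : t = [] := by
  cases h; rfl

theorem DerivesWithin.terminal_cons {n : ℕ} {a : T} {s t : List (Symbol T G.NT)}
    (h : DerivesWithin G n (terminal a :: s) t) :
    ∃ t', t = terminal a :: t' ∧ DerivesWithin G n s t' := by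
  cases h with
  | keep _ h => exact ⟨_, rfl, h⟩

theorem DerivesWithin.split_append {n : ℕ} {s s' t : List (Symbol T G.NT)}
    (h : DerivesWithin G n (s ++ s') t) :
    ∃ u u', t = u ++ u' ∧ DerivesWithin G n s u ∧ DerivesWithin G n s' u' := by
  induction s generalizing t with
  | nil => exact ⟨[], t, rfl, .nil n, h⟩
  | cons X s ih =>
    cases h with
    | keep _ h =>
      obtain ⟨u, u', rfl, hu, hu'⟩ := ih h
      exact ⟨X :: u, u', rfl, .keep X hu, hu'⟩
    | expand r hr hv h =>
      obtain ⟨u, u', rfl, hu, hu'⟩ := ih h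
      exact ⟨_, u', (List.append_assoc ..).symm, .expand r hr hv hu, hu'⟩

theorem derivesWithin_nonterminal_iff {n : ℕ} {A : G.NT} {t : List (Symbol T G.NT)} :
    DerivesWithin G n [nonterminal A] t ↔ t = [nonterminal A] ∨
      ∃ m, n = m + 1 ∧ ∃ r ∈ G.rules, r.input = A ∧ DerivesWithin G m r.output t := by
  constructor
  · intro h
    cases h with
    | keep _ h => exact .inl (by rw [h.eq_nil])
    | expand r hr hu h =>
      rw [h.eq_nil, List.append_nil]
      exact .inr ⟨_, rfl, r, hr, rfl, hu⟩
  · rintro (rfl | ⟨m, rfl, r, hr, rfl, h⟩)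
    · exact .refl n _
    · simpa using DerivesWithin.expand r hr h (.nil _)

theorem derives_append {s t s' t' : List (Symbol T G.NT)} (h : G.Derives s t)
    (h' : G.Derives s' t') : G.Derives (s ++ s') (t ++ t') :=
  (h.append_right s').trans (h'.append_left t)

theorem derives_of_mem_rules {r : ContextFreeRule T G.NT} (hr : r ∈ G.rules) :
    G.Derives [nonterminal r.input] r.output :=
  ContextFreeGrammar.Produces.single ⟨r, hr, .input_output⟩

theorem DerivesWithin.derives {n : ℕ} {s t : List (Symbol T G.NT)}
    (h : DerivesWithin G n s t) : G.Derives s t := by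
  induction h with
  | nil n => exact .refl _
  | keep X _ ih => exact ih.append_left [X]
  | expand r hr _ _ ihu ih => exact derives_append ((derives_of_mem_rules hr).trans ihu) ih

/-- Putting one rule application in front of a family of trees adds a level above some of them, so
each step raises the height bound by one. -/
theorem exists_derivesWithin {s t : List (Symbol T G.NT)} (h : G.Derives s t) :
    ∃ n, DerivesWithin G n s t := by
  induction h using Relation.ReflTransGen.head_induction_on with
  | refl => exact ⟨0, .refl 0 t⟩
  | head hp _ ih =>
    obtain ⟨n, hn⟩ := ih
    obtain ⟨r, hr, hrw⟩ := hp
    obtain ⟨p, q, rfl, rfl⟩ := hrw.exists_parts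
    obtain ⟨u, v, rfl, hu, hv⟩ := hn.split_append
    obtain ⟨u, w, rfl, hu, hw⟩ := hu.split_append
    refine ⟨n + 1, ?_⟩
    rw [List.append_assoc, List.append_assoc]
    exact (hu.mono n.le_succ).append (.expand r hr hw (hv.mono n.le_succ))

/-- A terminal of a derived string either is a symbol of the original string or is derived from
one of its nonterminals. -/
theorem DerivesWithin.locate {n : ℕ} {s p q : List (Symbol T G.NT)} {c : T}
    (h : DerivesWithin G n s (p ++ terminal c :: q)) :
    (∃ s₁ s₂, s = s₁ ++ terminal c :: s₂ ∧ DerivesWithin G n s₁ p ∧ DerivesWithin G n s₂ q) ∨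
    ∃ s₁ D s₂ p₁ p₂ q₁ q₂, s = s₁ ++ nonterminal D :: s₂ ∧ p = p₁ ++ p₂ ∧ q = q₁ ++ q₂ ∧
      DerivesWithin G n s₁ p₁ ∧ DerivesWithin G n [nonterminal D] (p₂ ++ terminal c :: q₁) ∧
      DerivesWithin G n s₂ q₂ := by
  induction s generalizing p with
  | nil => simpa using h.eq_nil
  | cons X s ih =>
    obtain ⟨u, v, huv, hu, hv⟩ := (show DerivesWithin G n ([X] ++ s) _ from h).split_append
    rcases List.append_eq_append_iff.1 huv.symm with ⟨p', rfl, hq⟩ | ⟨p', rfl, hq⟩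
    · subst hq
      rcases ih hv with ⟨s₁, s₂, rfl, h₁, h₂⟩ | ⟨s₁, D, s₂, p₁, p₂, q₁, q₂, rfl, rfl, rfl, h₁, h₂, h₃⟩
      · exact .inl ⟨X :: s₁, s₂, rfl, hu.append h₁, h₂⟩
      · exact .inr ⟨X :: s₁, D, s₂, u ++ p₁, p₂, q₁, q₂, rfl, (List.append_assoc ..).symm, rfl,
          hu.append h₁, h₂, h₃⟩
    · cases p' with
      | nil =>
        rw [List.append_nil] at hu
        rw [List.nil_append] at hq
        subst hq
        rcases ih (p := []) hv with ⟨s₁, s₂, rfl, h₁, h₂⟩ |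
          ⟨s₁, D, s₂, p₁, p₂, q₁, q₂, rfl, hp, rfl, h₁, h₂, h₃⟩
        · exact .inl ⟨X :: s₁, s₂, rfl, by simpa using hu.append h₁, h₂⟩
        · obtain ⟨rfl, rfl⟩ : p₁ = [] ∧ p₂ = [] := by simpa using hp.symm
          exact .inr ⟨X :: s₁, D, s₂, p, [], q₁, q₂, rfl, by simp, rfl,
            by simpa using hu.append h₁, h₂, h₃⟩
      | cons Y p' =>
        obtain ⟨rfl, rfl⟩ : terminal c = Y ∧ q = p' ++ v := by simpa using hq
        cases X with
        | terminal a =>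
          obtain ⟨t', ht, h'⟩ := hu.terminal_cons
          cases h'.eq_nil
          cases p with
          | nil =>
            simp only [List.nil_append, List.cons.injEq, Symbol.terminal.injEq] at ht
            obtain ⟨rfl, rfl⟩ := ht
            exact .inl ⟨[], s, rfl, .nil n, by simpa using hv⟩
          | cons Z p => simp at ht
        | nonterminal D =>
          exact .inr ⟨[], D, s, [], p, p', v, rfl, rfl, rfl, .nil n, hu, hv⟩

/-- A string from which a string without terminals is derived has no terminals. -/
theorem DerivesWithin.terminal_notMem {n : ℕ} {s t : List (Symbol T G.NT)}
    (h : DerivesWithin G n s t) (ht : ∀ a, terminal a ∉ t) (a : T) : terminal a ∉ s := by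
  intro ha
  obtain ⟨s₁, s₂, rfl⟩ := List.append_of_mem ha
  obtain ⟨u, v, rfl, -, hv⟩ := h.split_append
  obtain ⟨v', rfl, -⟩ := hv.terminal_cons
  exact ht a (by simp)

theorem terminal_notMem_optNonterminal {N : Type*} (e : Option N) (a : T) :
    terminal a ∉ optNonterminal (T := T) e := by
  cases e <;> simp [optNonterminal]

end Derivations

/-! ### Strings without adjacent nonterminals -/

section OperatorForms

variable {T N : Type*}

/-- A string without adjacent nonterminals. -/
def IsOperatorForm (s : List (Symbol T N)) : Prop :=
  ¬ ∃ (α β : List (Symbol T N)) (A B : N), s = α ++ [nonterminal A, nonterminal B] ++ β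

/-- The string of consecutive segments, each a terminal followed by an optional nonterminal. -/
def segments (l : List (T × Option N)) : List (Symbol T N) :=
  l.flatMap fun p => terminal p.1 :: optNonterminal p.2

@[simp] theorem segments_nil : segments ([] : List (T × Option N)) = [] := rfl

@[simp] theorem segments_cons (p : T × Option N) (l : List (T × Option N)) :
    segments (p :: l) = terminal p.1 :: (optNonterminal p.2 ++ segments l) := rfl

@[simp] theorem optNonterminal_none : optNonterminal (T := T) (none : Option N) = [] := rfl

@[simp] theorem optNonterminal_some (A : N) :
    optNonterminal (T := T) (some A) = [nonterminal A] := rfl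

theorem IsOperatorForm.of_infix {s t : List (Symbol T N)} (h : IsOperatorForm t)
    (hst : s <:+: t) : IsOperatorForm s := by
  rintro ⟨α, β, A, B, rfl⟩
  obtain ⟨u, v, rfl⟩ := hst
  exact h ⟨u ++ α, β ++ v, A, B, by simp⟩

theorem IsOperatorForm.starts_terminal {s₁ s₂ : List (Symbol T N)} {D : N}
    (h : IsOperatorForm (s₁ ++ nonterminal D :: s₂)) :
    s₂ = [] ∨ ∃ a s', s₂ = terminal a :: s' := by
  rcases s₂ with _ | ⟨a | B, s'⟩
  · exact .inl rfl
  · exact .inr ⟨a, s', rfl⟩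
  · exact (h ⟨s₁, s', D, B, by simp⟩).elim

theorem IsOperatorForm.ends_terminal {s₁ s₂ : List (Symbol T N)} {D : N}
    (h : IsOperatorForm (s₁ ++ nonterminal D :: s₂)) :
    s₁ = [] ∨ ∃ s' a, s₁ = s' ++ [terminal a] := by
  rcases List.eq_nil_or_concat' s₁ with rfl | ⟨s', a | B, rfl⟩
  · exact .inl rfl
  · exact .inr ⟨s', a, rfl⟩
  · exact (h ⟨s', s₂, B, D, by simp⟩).elim

theorem IsOperatorForm.eq_optNonterminal {s : List (Symbol T N)} (h : IsOperatorForm s)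
    (hs : ∀ a, terminal a ∉ s) : ∃ e, s = optNonterminal e := by
  rcases s with _ | ⟨a | A, s⟩
  · exact ⟨none, rfl⟩
  · exact (hs a (by simp)).elim
  · rcases h.starts_terminal (s₁ := []) with rfl | ⟨a, s', rfl⟩
    · exact ⟨some A, rfl⟩
    · exact (hs a (by simp)).elim

theorem IsOperatorForm.eq_segments {s : List (Symbol T N)} (h : IsOperatorForm s) :
    ∃ e l, s = optNonterminal e ++ segments l := by
  induction s with
  | nil => exact ⟨none, [], rfl⟩
  | cons X s ih =>
    obtain ⟨e, l, rfl⟩ := ih (h.of_infix (List.suffix_cons X s).isInfix)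
    cases X with
    | terminal a => exact ⟨none, (a, e) :: l, rfl⟩
    | nonterminal A =>
      cases e with
      | none => exact ⟨some A, l, rfl⟩
      | some B => exact (h ⟨[], segments l, A, B, rfl⟩).elim

end OperatorForms

/-! ### Handles delimited by precedence relations -/

section Handles

variable {T : Type*} {G : ContextFreeGrammar T} {M : PrecMatrix T}

theorem PrecMatrix.ConflictFree.eq (hM : M.ConflictFree) {a b : T} {ρ σ : PrecRel}
    (hρ : ρ ∈ M a b) (hσ : σ ∈ M a b) : ρ = σ :=
  Set.encard_le_one_iff.1 (hM a b) ρ σ hρ hσ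

/-- The relations are recorded in a matrix containing that of the grammar, so that relations coming
from two compatible grammars can be confronted in one matrix. -/
theorem yields_mem (hG : ∀ a b, opm G a b ⊆ M a b) {r} (hr : r ∈ G.rules)
    {α β p q : List (Symbol T G.NT)} {D : G.NT} {a b : T} (e : Option G.NT)
    (ho : r.output = α ++ terminal a :: nonterminal D :: β)
    (hD : G.Derives [nonterminal D] p) (hp : p = optNonterminal e ++ terminal b :: q) :
    PrecRel.yields ∈ M a b :=
  hG a b ⟨r, hr, α, β, D, by simp [ho], e, q, by simpa [hp] using hD⟩

theorem takes_mem (hG : ∀ a b, opm G a b ⊆ M a b) {r} (hr : r ∈ G.rules)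
    {α β p q : List (Symbol T G.NT)} {D : G.NT} {a b : T} (e : Option G.NT)
    (ho : r.output = α ++ nonterminal D :: terminal b :: β)
    (hD : G.Derives [nonterminal D] p) (hp : p = q ++ terminal a :: optNonterminal e) :
    PrecRel.takes ∈ M a b :=
  hG a b ⟨r, hr, α, β, D, by simp [ho], q, e, by simpa [hp] using hD⟩

theorem equal_mem (hG : ∀ a b, opm G a b ⊆ M a b) {r} (hr : r ∈ G.rules)
    {α β : List (Symbol T G.NT)} {a b : T} (e : Option G.NT)
    (ho : r.output = α ++ terminal a :: (optNonterminal e ++ terminal b :: β)) :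
    PrecRel.equal ∈ M a b :=
  hG a b ⟨r, hr, α, β, e, by simp [ho]⟩

/-- The string `x` is empty, or it ends with a terminal that yields precedence to `c`. -/
def LeftBound {N : Type*} (M : PrecMatrix T) (x : List (Symbol T N)) (c : T) : Prop :=
  x = [] ∨ ∃ x' a, x = x' ++ [terminal a] ∧ PrecRel.yields ∈ M a c

/-- The terminals `c`, `l` are consecutively equal in precedence, and the last of them takes
precedence over the first symbol of `y`, a terminal, unless `y` is empty. -/
def ChainTo {N : Type*} (M : PrecMatrix T) :
    T → List (T × Option N) → List (Symbol T N) → Prop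
  | c, [], y => y = [] ∨ ∃ b y', y = terminal b :: y' ∧ PrecRel.takes ∈ M c b
  | c, p :: l, y => PrecRel.equal ∈ M c p.1 ∧ ChainTo M p.1 l y

theorem ChainTo.of_append {N : Type*} {c : T} {l : List (T × Option N)}
    {y z : List (Symbol T N)} (h : ChainTo M c l (y ++ z)) : ChainTo M c l y := by
  induction l generalizing c with
  | nil =>
    rcases y with _ | ⟨Y, y⟩
    · exact .inl rfl
    · rcases h with h | ⟨b, y', h, hb⟩
      · simp at h
      · obtain ⟨rfl, rfl⟩ : Y = terminal b ∧ y ++ z = y' := by simpa using h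
        exact .inr ⟨b, y, rfl, hb⟩
  | cons p l ih => exact ⟨h.1, ih h.2⟩

theorem LeftBound.of_append {N : Type*} {c : T} {x z : List (Symbol T N)}
    (h : LeftBound M (z ++ x) c) : LeftBound M x c := by
  rcases List.eq_nil_or_concat' x with rfl | ⟨x, X, rfl⟩
  · exact .inl rfl
  · rcases h with h | ⟨x', a, h, ha⟩
    · simp at h
    · rw [← List.append_assoc] at h
      obtain ⟨-, h⟩ := List.append_inj' h rfl
      obtain rfl : X = terminal a := by simpa using h
      exact .inr ⟨x, a, rfl, ha⟩

variable (hop : IsOperatorGrammar G) (hG : ∀ a b, opm G a b ⊆ M a b)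

theorem IsOperatorGrammar.isOperatorForm (hop : IsOperatorGrammar G) {r} (hr : r ∈ G.rules) :
    IsOperatorForm r.output := hop r hr

include hop hG

/-- The terminal a either belongs to the same right-hand side as c, or lies under a nonterminal D.
In the second case D is adjacent to c: by the operator form a terminal would otherwise follow D and
survive between a and c. -/
theorem previous_terminal {r} (hr : r ∈ G.rules) {n : ℕ} {s β p : List (Symbol T G.NT)}
    {a c : T} {e : Option G.NT} (ho : r.output = s ++ terminal c :: β)
    (h : DerivesWithin G n s (p ++ terminal a :: optNonterminal e)) :
    PrecRel.equal ∈ M a c ∨ PrecRel.takes ∈ M a c := by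
  have hs : IsOperatorForm s := (hop.isOperatorForm hr).of_infix ⟨[], terminal c :: β, by simp [ho]⟩
  rcases h.locate with ⟨s₁, s₂, rfl, h₁, h₂⟩ |
    ⟨s₁, D, s₂, p₁, p₂, q₁, q₂, rfl, rfl, hq, h₁, h₂, h₃⟩
  · obtain ⟨e', rfl⟩ := (hs.of_infix ⟨s₁ ++ [terminal a], [], by simp⟩).eq_optNonterminal
      (h₂.terminal_notMem (terminal_notMem_optNonterminal e))
    exact .inl (equal_mem hG hr e' (by simpa using ho))
  · have hq₂ : ∀ b, terminal b ∉ q₂ := fun b hb =>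
      terminal_notMem_optNonterminal e b (by simp [hq, hb])
    rcases hs.starts_terminal with rfl | ⟨b, s', rfl⟩
    · rw [h₃.eq_nil, List.append_nil] at hq
      exact .inr (takes_mem hG hr e (by simpa using ho) h₂.derives (by rw [hq]))
    · exact (h₃.terminal_notMem hq₂ b (by simp)).elim

theorem next_terminal {r} (hr : r ∈ G.rules) {n : ℕ} {α s q : List (Symbol T G.NT)}
    {c d : T} {e : Option G.NT} (ho : r.output = α ++ terminal c :: s)
    (h : DerivesWithin G n s (optNonterminal e ++ terminal d :: q)) :
    (PrecRel.equal ∈ M c d ∧ ∃ s₁ s₂, s = s₁ ++ terminal d :: s₂ ∧ DerivesWithin G n s₂ q) ∨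
      PrecRel.yields ∈ M c d := by
  have hs : IsOperatorForm s :=
    (hop.isOperatorForm hr).of_infix ⟨α ++ [terminal c], [], by simp [ho]⟩
  rcases h.locate with ⟨s₁, s₂, rfl, h₁, h₂⟩ |
    ⟨s₁, D, s₂, p₁, p₂, q₁, q₂, rfl, hp, rfl, h₁, h₂, h₃⟩
  · obtain ⟨e', rfl⟩ := (hs.of_infix ⟨[], terminal d :: s₂, by simp⟩).eq_optNonterminal
      (h₁.terminal_notMem (terminal_notMem_optNonterminal e))
    exact .inl ⟨equal_mem hG hr e' ho, _, _, rfl, h₂⟩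
  · have hp₁ : ∀ b, terminal b ∉ p₁ := fun b hb =>
      terminal_notMem_optNonterminal e b (by simp [hp, hb])
    rcases hs.ends_terminal with rfl | ⟨s', b, rfl⟩
    · rw [h₁.eq_nil, List.nil_append] at hp
      exact .inr (yields_mem hG hr e (by simpa using ho) h₂.derives (by rw [hp]))
    · exact (h₁.terminal_notMem hp₁ b (by simp)).elim

variable (hM : M.ConflictFree)
include hM

/-- A terminal before c would be ≐ or ⋗ to it by `previous_terminal`, in conflict with the ⋖ of the
left bound. -/
theorem LeftBound.eq_nil {r} (hr : r ∈ G.rules) {n : ℕ} {s β x : List (Symbol T G.NT)}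
    {c : T} {e : Option G.NT} (ho : r.output = s ++ terminal c :: β)
    (h : DerivesWithin G n s (x ++ optNonterminal e)) (hx : LeftBound M x c) : x = [] := by
  rcases hx with rfl | ⟨x', a, rfl, ha⟩
  · rfl
  · rw [List.append_assoc] at h
    rcases previous_terminal hop hG hr ho h with h | h <;> cases hM.eq ha h

/-- Each ≐ of the chain excludes the ⋖ alternative of `next_terminal`, so the chain stays in the
right-hand side of c; its final ⋗ excludes both alternatives. -/
theorem ChainTo.eq_nil {r} (hr : r ∈ G.rules) {n : ℕ} {α s y : List (Symbol T G.NT)}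
    {c : T} {e : Option G.NT} {l : List (T × Option G.NT)} (ho : r.output = α ++ terminal c :: s)
    (h : DerivesWithin G n s (optNonterminal e ++ (segments l ++ y))) (hl : ChainTo M c l y) :
    y = [] := by
  induction l generalizing α s c e with
  | nil =>
    rcases hl with rfl | ⟨b, y', rfl, hb⟩
    · rfl
    · rcases next_terminal hop hG hr ho h with ⟨h, -⟩ | h <;> cases hM.eq hb h
  | cons p l ih =>
    rw [segments_cons, List.cons_append] at h
    rcases next_terminal hop hG hr ho h with ⟨-, s₁, s₂, rfl, h'⟩ | h'
    · exact ih (α := α ++ terminal c :: s₁) (by simpa using ho)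
        (by rwa [List.append_assoc] at h') hl.2
    · cases hM.eq hl.1 h'

omit hG hM in
-- The nonterminal in front of the handle cannot come from the left of D, because what stands there
-- is empty or ends with a terminal.
theorem child_left {r} (hr : r ∈ G.rules) {n : ℕ} {s₁ s₂ p₁ p₂ x : List (Symbol T G.NT)}
    {D : G.NT} {e : Option G.NT} (ho : r.output = s₁ ++ nonterminal D :: s₂)
    (h : DerivesWithin G n s₁ p₁) (hx : x ++ optNonterminal e = p₁ ++ p₂) :
    ∃ z, p₂ = z ++ optNonterminal e ∧ x = p₁ ++ z := by
  have hs := hop.isOperatorForm hr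
  rw [ho] at hs
  cases e with
  | none => exact ⟨p₂, by simp, by simpa using hx⟩
  | some B =>
    rcases List.eq_nil_or_concat' p₂ with rfl | ⟨z, Z, rfl⟩
    · rcases hs.ends_terminal with rfl | ⟨s', a, rfl⟩
      · simp [h.eq_nil] at hx
      · obtain ⟨u, v, rfl, -, hv⟩ := h.split_append
        obtain ⟨v', rfl, hv'⟩ := hv.terminal_cons
        cases hv'.eq_nil
        rw [List.append_nil] at hx
        have := (List.append_inj' hx rfl).2
        simp at this
    · rw [← List.append_assoc] at hx
      obtain ⟨h₁, h₂⟩ := List.append_inj' hx rfl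
      exact ⟨z, by rw [h₂], h₁⟩

/-- If the frontier of D stopped inside the chain, its last terminal would take precedence over the
terminal following D, whereas the chain makes them ≐. So the whole handle lies under D. -/
theorem child_right {r} (hr : r ∈ G.rules) {n : ℕ} {s₁ s₂ p q₁ q₂ y : List (Symbol T G.NT)}
    {D : G.NT} {c : T} {e : Option G.NT} {l : List (T × Option G.NT)}
    (ho : r.output = s₁ ++ nonterminal D :: s₂)
    (hD : DerivesWithin G n [nonterminal D] (p ++ terminal c :: q₁))
    (h : DerivesWithin G n s₂ q₂)
    (hq : optNonterminal e ++ (segments l ++ y) = q₁ ++ q₂) (hl : ChainTo M c l y) :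
    ∃ z, q₁ = optNonterminal e ++ (segments l ++ z) ∧ y = z ++ q₂ := by
  have hs := hop.isOperatorForm hr
  rw [ho] at hs
  rcases hs.starts_terminal with rfl | ⟨b, s', rfl⟩
  · cases h.eq_nil
    exact ⟨y, by simpa using hq.symm, by simp⟩
  obtain ⟨q', rfl, -⟩ := h.terminal_cons
  have key : ∀ (t : List (Symbol T G.NT)) (e : Option G.NT) (q₁ : List (Symbol T G.NT)),
      optNonterminal e ++ t = q₁ ++ terminal b :: q' →
      ∃ z, q₁ = optNonterminal e ++ z ∧ t = z ++ terminal b :: q' := by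
    intro t e q₁ ht
    cases e with
    | none => exact ⟨q₁, rfl, ht⟩
    | some B =>
      cases q₁ with
      | nil => simp at ht
      | cons Z q₁ =>
        obtain ⟨rfl, rfl⟩ : nonterminal B = Z ∧ t = q₁ ++ terminal b :: q' := by simpa using ht
        exact ⟨q₁, rfl, rfl⟩
  induction l generalizing p c e q₁ with
  | nil => exact key _ _ _ hq
  | cons d l ih =>
    obtain ⟨z, rfl, hz⟩ := key _ _ _ hq
    cases z with
    | nil =>
      obtain ⟨hd, -⟩ : d.1 = b ∧ _ := by simpa using hz
      have := takes_mem hG hr e ho hD.derives (by rw [List.append_nil])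
      cases hM.eq hl.1 (hd ▸ this)
    | cons Z z =>
      obtain ⟨rfl, hz'⟩ : terminal d.1 = Z ∧
        optNonterminal d.2 ++ (segments l ++ y) = z ++ terminal b :: q' := by simpa using hz
      obtain ⟨z, rfl, rfl⟩ := ih (p := p ++ terminal c :: optNonterminal e) (by simpa using hD)
        hl.2 hz'
      exact ⟨z, by simp, rfl⟩

/-- A handle, delimited by the precedence relations, can be the last part to be derived. -/
theorem handle {n : ℕ} {A : G.NT} {x y : List (Symbol T G.NT)} {c : T} {e e' : Option G.NT}
    {l : List (T × Option G.NT)}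
    (h : DerivesWithin G n [nonterminal A]
      (x ++ (optNonterminal e ++ terminal c :: (optNonterminal e' ++ (segments l ++ y)))))
    (hx : LeftBound M x c) (hl : ChainTo M c l y) :
    ∃ B, G.Derives [nonterminal A] (x ++ nonterminal B :: y) ∧
      G.Derives [nonterminal B]
        (optNonterminal e ++ terminal c :: (optNonterminal e' ++ segments l)) := by
  induction n generalizing A x y with
  | zero =>
    rcases derivesWithin_nonterminal_iff.1 h with h | ⟨m, hm, -⟩
    · have : terminal c ∈ [nonterminal A] := by rw [← h]; simp
      simp at this
    · omega
  | succ n ih =>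
    rcases derivesWithin_nonterminal_iff.1 h with h | ⟨m, hm, r, hr, rfl, h'⟩
    · have : terminal c ∈ [nonterminal A] := by rw [← h]; simp
      simp at this
    obtain rfl : n = m := by omega
    rw [← List.append_assoc] at h'
    -- If c belongs to the root rule, conflict-freeness forces x and y to be empty and the root
    -- itself is B. Otherwise the whole handle lies under one child, and the induction descends into
    -- it.
    rcases h'.locate with ⟨s₁, s₂, ho, h₁, h₂⟩ |
      ⟨s₁, D, s₂, p₁, p₂, q₁, q₂, ho, hp, hq, h₁, h₂, h₃⟩
    · cases hx.eq_nil hop hG hM hr ho h₁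
      cases hl.eq_nil hop hG hM hr ho h₂
      exact ⟨r.input, .refl _, by simpa using h.derives⟩
    · obtain ⟨z, rfl, rfl⟩ := child_left hop hr ho h₁ hp
      obtain ⟨w, rfl, rfl⟩ := child_right hop hG hM hr ho h₂ h₃ hq hl
      obtain ⟨B, hB, hB'⟩ := ih (A := D) (x := z) (y := w) (by simpa using h₂) hx.of_append
        hl.of_append
      refine ⟨B, (derives_of_mem_rules hr).trans ?_, hB'⟩
      rw [ho]
      have := derives_append (derives_append h₁.derives hB) h₃.derives
      simpa using this

end Handles

/-! ### Reducing in one grammar the phrases of the other -/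

section Reduction

variable {T : Type*} {G G' : ContextFreeGrammar T} {M : PrecMatrix T}

/-- The string `x` is empty, or it ends with a terminal that yields precedence to the left
terminals of `A`. -/
def LeftContext {N : Type*} (M : PrecMatrix T) (G : ContextFreeGrammar T) (A : G.NT)
    (x : List (Symbol T N)) : Prop :=
  x = [] ∨ ∃ x' a, x = x' ++ [terminal a] ∧ ∀ c ∈ leftTerminals G A, PrecRel.yields ∈ M a c

/-- The string `y` is empty, or it starts with a terminal over which the right terminals of `A`
take precedence. -/
def RightContext {N : Type*} (M : PrecMatrix T) (G : ContextFreeGrammar T) (A : G.NT)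
    (y : List (Symbol T N)) : Prop :=
  y = [] ∨ ∃ b y', y = terminal b :: y' ∧ ∀ c ∈ rightTerminals G A, PrecRel.takes ∈ M c b

theorem mem_leftTerminals_of_output {r} (hr : r ∈ G.rules) {c : T} {e : Option G.NT}
    {β : List (Symbol T G.NT)} (ho : r.output = optNonterminal e ++ terminal c :: β) :
    c ∈ leftTerminals G r.input :=
  ⟨e, β, by simpa [ho] using derives_of_mem_rules hr⟩

theorem mem_rightTerminals_of_output {r} (hr : r ∈ G.rules) {c : T} {e : Option G.NT}
    {α : List (Symbol T G.NT)} (ho : r.output = α ++ terminal c :: optNonterminal e) :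
    c ∈ rightTerminals G r.input :=
  ⟨α, e, by simpa [ho] using derives_of_mem_rules hr⟩

theorem leftTerminals_subset_of_output {r} (hr : r ∈ G.rules) {D : G.NT}
    {β : List (Symbol T G.NT)} (ho : r.output = nonterminal D :: β) :
    leftTerminals G D ⊆ leftTerminals G r.input := by
  rintro c ⟨e, γ, h⟩
  refine ⟨e, γ ++ β, (derives_of_mem_rules hr).trans ?_⟩
  rw [ho]
  simpa using h.append_right β

theorem rightTerminals_subset_of_output {r} (hr : r ∈ G.rules) {D : G.NT}
    {α : List (Symbol T G.NT)} (ho : r.output = α ++ [nonterminal D]) :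
    rightTerminals G D ⊆ rightTerminals G r.input := by
  rintro c ⟨γ, e, h⟩
  refine ⟨α ++ γ, e, (derives_of_mem_rules hr).trans ?_⟩
  rw [ho]
  simpa using h.append_left α

theorem LeftContext.mono {N : Type*} {A B : G.NT} {x : List (Symbol T N)}
    (h : LeftContext M G A x) (hs : leftTerminals G B ⊆ leftTerminals G A) :
    LeftContext M G B x :=
  h.imp_right fun ⟨x', a, hx, ha⟩ => ⟨x', a, hx, fun c hc => ha c (hs hc)⟩

theorem RightContext.mono {N : Type*} {A B : G.NT} {y : List (Symbol T N)}
    (h : RightContext M G A y) (hs : rightTerminals G B ⊆ rightTerminals G A) :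
    RightContext M G B y :=
  h.imp_right fun ⟨b, y', hy, hb⟩ => ⟨b, y', hy, fun c hc => hb c (hs hc)⟩

theorem DerivesWithin.split_append_word {n : ℕ} {s s' : List (Symbol T G.NT)} {w : List T}
    (h : DerivesWithin G n (s ++ s') (w.map terminal)) :
    ∃ u v, w = u ++ v ∧ DerivesWithin G n s (u.map terminal) ∧
      DerivesWithin G n s' (v.map terminal) := by
  obtain ⟨u, v, huv, hu, hv⟩ := h.split_append
  obtain ⟨u, v, rfl, rfl, rfl⟩ := List.map_eq_append_iff.1 huv
  exact ⟨u, v, rfl, hu, hv⟩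

theorem DerivesWithin.terminal_cons_word {n : ℕ} {s : List (Symbol T G.NT)} {a : T} {w : List T}
    (h : DerivesWithin G n (terminal a :: s) (w.map terminal)) :
    ∃ v, w = a :: v ∧ DerivesWithin G n s (v.map terminal) := by
  obtain ⟨t, ht, h'⟩ := h.terminal_cons
  obtain ⟨b, v, rfl, hb, rfl⟩ := List.map_eq_cons_iff.1 ht
  obtain rfl : b = a := by simpa using hb
  exact ⟨v, rfl, h'⟩

theorem LeftContext.of_output {N : Type*} (hG : ∀ a b, opm G a b ⊆ M a b) {r} (hr : r ∈ G.rules)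
    {D : G.NT} {a : T} {α β : List (Symbol T G.NT)}
    (ho : r.output = α ++ terminal a :: nonterminal D :: β) (x : List (Symbol T N)) :
    LeftContext M G D (x ++ [terminal a]) :=
  .inr ⟨x, a, rfl, fun _ ⟨e, _, h⟩ => yields_mem hG hr e ho h (by simp; rfl)⟩

theorem RightContext.of_output {N : Type*} (hG : ∀ a b, opm G a b ⊆ M a b) {r} (hr : r ∈ G.rules)
    {D : G.NT} {b : T} {α β : List (Symbol T G.NT)}
    (ho : r.output = α ++ nonterminal D :: terminal b :: β) (y : List (Symbol T N)) :
    RightContext M G D (terminal b :: y) :=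
  .inr ⟨b, y, rfl, fun _ ⟨_, e, h⟩ => takes_mem hG hr e ho h (by simp; rfl)⟩

/-- The nonempty words derived within height `n` in `G` can be reduced in `G'` to a nonterminal,
wherever the precedence relations delimit them. -/
def Reduces (M : PrecMatrix T) (G G' : ContextFreeGrammar T) (n : ℕ) : Prop :=
  ∀ ⦃A : G.NT⦄ ⦃w : List T⦄ ⦃x y : List (Symbol T G'.NT)⦄ ⦃S : G'.NT⦄,
    DerivesWithin G n [nonterminal A] (w.map terminal) → w ≠ [] →
    LeftContext M G A x → RightContext M G A y →
    G'.Derives [nonterminal S] (x ++ (w.map terminal ++ y)) →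
    ∃ B, G'.Derives [nonterminal S] (x ++ nonterminal B :: y) ∧
      G'.Derives [nonterminal B] (w.map terminal)

variable (hG : ∀ a b, opm G a b ⊆ M a b)
include hG

/-- Treats the possible nonterminal before the next terminal of a right-hand side. Its yield is
reduced by `hn` when nonempty; an empty yield leaves no nonterminal. -/
theorem Reduces.gap {n : ℕ} (hn : Reduces M G G' n) {r} (hr : r ∈ G.rules)
    {α : List (Symbol T G.NT)} {e : Option G.NT} {l : List (T × Option G.NT)} {w : List T}
    {x y : List (Symbol T G'.NT)} {S : G'.NT}
    (ho : r.output = α ++ (optNonterminal e ++ segments l))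
    (h : DerivesWithin G n (optNonterminal e ++ segments l) (w.map terminal))
    (hx : ∀ D, e = some D → LeftContext M G D x) (hy : RightContext M G r.input y)
    (hS : G'.Derives [nonterminal S] (x ++ (w.map terminal ++ y))) :
    ∃ w₁ w₂ e', w = w₁ ++ w₂ ∧ DerivesWithin G n (segments l) (w₂.map terminal) ∧
      G'.Derives [nonterminal S] (x ++ (optNonterminal e' ++ (w₂.map terminal ++ y))) ∧
      G'.Derives (optNonterminal e') (w₁.map terminal) := by
  obtain ⟨w₁, w₂, rfl, h₁, h₂⟩ := h.split_append_word
  by_cases hw : w₁ = []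
  · subst hw
    exact ⟨[], w₂, none, rfl, h₂, by simpa using hS, .refl _⟩
  cases e with
  | none => exact (hw (by simpa using h₁.eq_nil)).elim
  | some D =>
    have hD : RightContext M G D (w₂.map terminal ++ y) := by
      cases l with
      | nil =>
        obtain rfl : w₂ = [] := by simpa using h₂.eq_nil
        exact hy.mono (rightTerminals_subset_of_output hr (α := α) (by simpa using ho))
      | cons p l =>
        obtain ⟨v, rfl, -⟩ := h₂.terminal_cons_word
        exact .of_output hG hr (by simpa using ho) _
    obtain ⟨B, hB, hB'⟩ := hn h₁ hw (hx D rfl) hD (by simpa using hS)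
    exact ⟨w₁, w₂, some B, rfl, h₂, by simpa using hB, hB'⟩

/-- The gaps are reduced from left to right: x collects the part already reduced, the rest is still
a word. The terminals of one right-hand side are consecutively ≐, and the right context provides the
closing ⋗. -/
theorem Reduces.chain {n : ℕ} (hn : Reduces M G G' n) {r} (hr : r ∈ G.rules)
    {α : List (Symbol T G.NT)} {c : T} {e : Option G.NT} {l : List (T × Option G.NT)} {w : List T}
    {x y : List (Symbol T G'.NT)} {S : G'.NT}
    (ho : r.output = α ++ terminal c :: (optNonterminal e ++ segments l))
    (h : DerivesWithin G n (optNonterminal e ++ segments l) (w.map terminal))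
    (hy : RightContext M G r.input y)
    (hS : G'.Derives [nonterminal S] (x ++ terminal c :: (w.map terminal ++ y))) :
    ∃ (e' : Option G'.NT) (l' : List (T × Option G'.NT)),
      G'.Derives [nonterminal S]
        (x ++ terminal c :: (optNonterminal e' ++ (segments l' ++ y))) ∧
      G'.Derives (optNonterminal e' ++ segments l') (w.map terminal) ∧ ChainTo M c l' y := by
  induction l generalizing α c e w x with
  | nil =>
    obtain ⟨w₁, w₂, e', rfl, h₂, hS', he'⟩ := hn.gap hG hr (x := x ++ [terminal c])
      (α := α ++ [terminal c]) (by simpa using ho) h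
      (by rintro D rfl; exact .of_output hG hr (by simpa using ho) x) hy (by simpa using hS)
    obtain rfl : w₂ = [] := by simpa using h₂.eq_nil
    refine ⟨e', [], by simpa using hS', by simpa using he', ?_⟩
    exact hy.imp_right fun ⟨b, y', hyb, hb⟩ =>
      ⟨b, y', hyb, hb c (mem_rightTerminals_of_output hr (by simpa using ho))⟩
  | cons p l ih =>
    obtain ⟨w₁, w₂, e', rfl, h₂, hS', he'⟩ := hn.gap hG hr (x := x ++ [terminal c])
      (α := α ++ [terminal c]) (by simpa using ho) h
      (by rintro D rfl; exact .of_output hG hr (by simpa using ho) x) hy (by simpa using hS)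
    obtain ⟨v, rfl, h₃⟩ := h₂.terminal_cons_word
    obtain ⟨e'', l', hS'', hl', hc⟩ := ih (c := p.1) (e := p.2)
      (α := α ++ terminal c :: optNonterminal e)
      (x := x ++ terminal c :: optNonterminal e') (by simpa using ho) h₃ (by simpa using hS')
    refine ⟨e', (p.1, e'') :: l', by simpa using hS'', ?_, equal_mem hG hr e (by simpa using ho),
      hc⟩
    simpa using derives_append he' (hl'.append_left [terminal p.1])

variable (hop : IsOperatorGrammar G) (hop' : IsOperatorGrammar G')
  (hG' : ∀ a b, opm G' a b ⊆ M a b) (hM : M.ConflictFree)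
include hop hop' hG' hM

/-- By induction, `G'` reduces the yields of the children of the root. What remains has the
terminals of a right-hand side of `G`, hence is a handle for `M`, and `handle` supplies the
nonterminal of `G'`. -/
theorem reduces (n : ℕ) : Reduces M G G' n := by
  induction n with
  | zero =>
    intro A w x y S h
    rcases derivesWithin_nonterminal_iff.1 h with h | ⟨m, hm, -⟩
    · rcases w with _ | ⟨a, w⟩ <;> simp at h
    · omega
  | succ n ih =>
    intro A w x y S h hw hx hy hS
    rcases derivesWithin_nonterminal_iff.1 h with h | ⟨m, hm, r, hr, rfl, h'⟩
    · rcases w with _ | ⟨a, w⟩ <;> simp at h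
    obtain rfl : n = m := by omega
    obtain ⟨e, l, ho⟩ := (hop.isOperatorForm hr).eq_segments
    rw [ho] at h'
    have hx' : ∀ D, e = some D → LeftContext M G D x := by
      rintro D rfl
      exact hx.mono (leftTerminals_subset_of_output hr ho)
    obtain ⟨w₁, w₂, e₁, rfl, h₂, hS₁, he₁⟩ := ih.gap hG hr (α := []) ho h' hx' hy hS
    cases l with
    -- No terminal in the right-hand side: the nonterminal obtained for its only symbol already
    -- serves, and it exists because the word is nonempty.
    | nil =>
      obtain rfl : w₂ = [] := by simpa using h₂.eq_nil
      cases e₁ with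
      | none =>
        obtain ⟨n, hn⟩ := exists_derivesWithin he₁
        exact (hw (by simpa using hn.eq_nil)).elim
      | some B => exact ⟨B, by simpa using hS₁, by simpa using he₁⟩
    | cons p l =>
      obtain ⟨v, rfl, h₃⟩ := h₂.terminal_cons_word
      obtain ⟨e₂, l', hS₂, hl', hc⟩ := ih.chain hG hr (x := x ++ optNonterminal e₁)
        (α := optNonterminal e) (by simpa using ho) h₃ hy (by simpa using hS₁)
      obtain ⟨k, hk⟩ := exists_derivesWithin hS₂
      obtain ⟨B, hB, hB'⟩ := handle hop' hG' hM (x := x) (e := e₁) (by simpa using hk)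
        (hx.imp_right fun ⟨x', a, hxa, ha⟩ =>
          ⟨x', a, hxa, ha p.1 (mem_leftTerminals_of_output hr (e := e) (by simpa using ho))⟩) hc
      refine ⟨B, hB, hB'.trans ?_⟩
      simpa using derives_append he₁ (hl'.append_left [terminal p.1])

end Reduction

/-! ### Bounds on the height of trees -/

section Bounds

/-- An increasing sequence of subsets of a finite set that stays constant once it repeats a value
has reached its largest value after as many steps as the finite set has elements. -/
theorem subset_of_stabilises {α : Type*} {U : ℕ → Set α} {F : Finset α} {b : ℕ}
    (hU : Monotone U) (hF : ∀ n, U n ⊆ F) (hs : ∀ n, U (n + 1) ⊆ U n → U (n + 2) ⊆ U (n + 1))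
    (hb : F.card ≤ b) (n : ℕ) : U n ⊆ U b := by
  have hfin : ∀ n, (U n).Finite := fun n => F.finite_toSet.subset (hF n)
  have hmono : Monotone fun n => (U n).ncard := fun m n h =>
    Set.ncard_le_ncard (hU h) (hfin n)
  have hle : ∀ n, (U n).ncard ≤ b := fun n =>
    (Set.ncard_le_ncard (hF n) F.finite_toSet).trans (by simpa using hb)
  have hst : ∀ n, (U n).ncard = (U (n + 1)).ncard → (U (n + 1)).ncard = (U (n + 2)).ncard := by
    intro n hn
    have h₁ : U n = U (n + 1) :=
      Set.eq_of_subset_of_ncard_le (hU n.le_succ) hn.ge (hfin (n + 1))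
    rw [(hs n h₁.ge).antisymm (hU (n + 1).le_succ)]
  rcases le_total n b with h | h
  · exact hU h
  · have := Nat.stabilises_of_monotone hmono hle hst h
    rw [Set.eq_of_subset_of_ncard_le (hU h) this.le (hfin n)]

variable {T : Type*} {G G' : ContextFreeGrammar T} {M : PrecMatrix T}

theorem exists_input_of_derives_word {A : G.NT} {w : List T}
    (h : G.Derives [nonterminal A] (w.map terminal)) : ∃ r ∈ G.rules, r.input = A := by
  obtain ⟨n, hn⟩ := exists_derivesWithin h
  rcases derivesWithin_nonterminal_iff.1 hn with h | ⟨m, -, r, hr, hA, -⟩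
  · rcases w with _ | ⟨a, w⟩ <;> simp at h
  · exact ⟨r, hr, hA⟩

theorem derivesWithin_word_iff {n : ℕ} {A : G.NT} {w : List T} :
    DerivesWithin G n [nonterminal A] (w.map terminal) ↔
      ∃ m, n = m + 1 ∧ ∃ r ∈ G.rules, r.input = A ∧ DerivesWithin G m r.output (w.map terminal) := by
  rw [derivesWithin_nonterminal_iff]
  refine or_iff_right fun h => ?_
  rcases w with _ | ⟨a, w⟩ <;> simp at h

/-- The height of the derivation trees of a word can be bounded in terms of its length. -/
theorem DerivesWithin.of_word_bound {n b : ℕ} {A : G.NT} {w : List T}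
    (h : DerivesWithin G n [nonterminal A] (w.map terminal))
    (hb : G.rules.card * 2 ^ w.length ≤ b) :
    DerivesWithin G b [nonterminal A] (w.map terminal) := by
  classical
  -- Yields of subtrees are sublists of `w`, of which there are at most `2 ^ w.length`. Only
  -- left-hand sides of rules derive words, which bounds the nonterminals even though their type may
  -- be infinite.
  let U : ℕ → Set (G.NT × List T) := fun n =>
    {p | p.2.Sublist w ∧ DerivesWithin G n [nonterminal p.1] (p.2.map terminal)}
  have key := subset_of_stabilises (U := U) (b := b)
    (F := G.rules.image ContextFreeRule.input ×ˢ w.sublists.toFinset)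
    (fun m n hmn p hp => ⟨hp.1, hp.2.mono hmn⟩) ?_ ?_ ?_ n
  · exact (key (a := (A, w)) ⟨List.Sublist.refl w, h⟩).2
  · rintro n ⟨A, v⟩ ⟨hv, hA⟩
    simpa [hv] using exists_input_of_derives_word hA.derives
  · rintro n hn ⟨A, v⟩ ⟨hv, hA⟩
    refine ⟨hv, ?_⟩
    obtain ⟨m, hm, r, hr, hA, h⟩ := derivesWithin_word_iff.1 hA
    obtain rfl : m = n + 1 := by omega
    refine derivesWithin_word_iff.2 ⟨n, rfl, r, hr, hA, ?_⟩
    generalize r.output = s at h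
    dsimp only at hv h ⊢
    clear * - hn hv h
    induction s generalizing v with
    | nil => rw [h.eq_nil]; exact .nil n
    | cons X s ih =>
      obtain ⟨v₁, v₂, rfl, h₁, h₂⟩ := (show DerivesWithin G _ ([X] ++ s) _ from h).split_append_word
      rw [List.map_append]
      refine DerivesWithin.append (s := [X]) ?_ (ih v₂ ((List.sublist_append_right _ _).trans hv) h₂)
      cases X with
      | terminal a =>
        obtain ⟨t, ht, h'⟩ := h₁.terminal_cons
        rw [ht, h'.eq_nil]
        exact .refl n _
      | nonterminal B =>
        exact (hn (a := (B, v₁)) ⟨(List.sublist_append_left _ _).trans hv, h₁⟩).2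
  · refine le_trans ?_ hb
    rw [Finset.card_product]
    exact Nat.mul_le_mul Finset.card_image_le
      ((List.toFinset_card_le _).trans (List.length_sublists w).le)

/-- Two words that are derived from the same nonterminals, both empty or both nonempty. -/
def SameType (G : ContextFreeGrammar T) (u v : List T) : Prop :=
  (u = [] ↔ v = []) ∧ ∀ B, G.Derives [nonterminal B] (u.map terminal) ↔
    G.Derives [nonterminal B] (v.map terminal)

theorem SameType.symm {u v : List T} (h : SameType G u v) : SameType G v u :=
  ⟨h.1.symm, fun B => (h.2 B).symm⟩

variable (hG : ∀ a b, opm G a b ⊆ M a b) (hop : IsOperatorGrammar G)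
  (hop' : IsOperatorGrammar G') (hG' : ∀ a b, opm G' a b ⊆ M a b) (hM : M.ConflictFree)
include hop hG hop' hG' hM

/-- By `reduces`, a nonempty u can be reduced to some B, from which v is derived as well. Emptiness
is part of the type because `reduces` does not apply to the empty word. -/
theorem SameType.replace {n : ℕ} {A : G.NT} {u v : List T} (h : SameType G' u v)
    (hu : DerivesWithin G n [nonterminal A] (u.map terminal))
    {x y : List (Symbol T G'.NT)} (hx : LeftContext M G A x) (hy : RightContext M G A y) {S : G'.NT}
    (hS : G'.Derives [nonterminal S] (x ++ (u.map terminal ++ y))) :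
    G'.Derives [nonterminal S] (x ++ (v.map terminal ++ y)) := by
  by_cases hu₀ : u = []
  · rwa [h.1.1 hu₀, ← hu₀]
  obtain ⟨B, hB, hB'⟩ := reduces hG hop hop' hG' hM n hu hu₀ hx hy hS
  refine hB.trans (ContextFreeGrammar.Derives.append_left ?_ x)
  exact ((h.2 B).1 hB').append_right y

/-- The yields of the children are exchanged one after the other, from left to right, each by
`SameType.replace`. The word x stands for what precedes; all that is kept of it is that it agrees
with α in being empty or in its last terminal, which suffices for the left context. -/
theorem exists_sameType_of_output {n : ℕ}
    (hn : ∀ A w, DerivesWithin G (n + 1) [nonterminal A] (w.map terminal) →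
      ∃ w', DerivesWithin G n [nonterminal A] (w'.map terminal) ∧ SameType G' w w')
    {r} (hr : r ∈ G.rules) {α s : List (Symbol T G.NT)} (ho : r.output = α ++ s) {v : List T}
    (h : DerivesWithin G (n + 1) s (v.map terminal)) :
    ∃ v', DerivesWithin G n s (v'.map terminal) ∧ (v = [] ↔ v' = []) ∧
      ∀ x : List T, (α = [] → x = []) → (∀ α' a, α = α' ++ [terminal a] → ∃ x', x = x' ++ [a]) →
        ∀ S, G'.Derives [nonterminal S] ((x ++ v).map terminal) ↔
          G'.Derives [nonterminal S] ((x ++ v').map terminal) := by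
  induction s generalizing α v with
  | nil =>
    obtain rfl : v = [] := by simpa using h.eq_nil
    exact ⟨[], .nil n, .rfl, fun _ _ _ _ => .rfl⟩
  | cons X s ih =>
    obtain ⟨v₁, v₂, rfl, h₁, h₂⟩ := (show DerivesWithin G _ ([X] ++ s) _ from h).split_append_word
    obtain ⟨v₂', h₂', he, hv₂⟩ := ih (α := α ++ [X]) (by simpa using ho) h₂
    cases X with
    | terminal a =>
      obtain ⟨t, rfl, h'⟩ := h₁.terminal_cons_word
      obtain rfl : t = [] := by simpa using h'.eq_nil
      refine ⟨a :: v₂', .keep _ h₂', by simp, fun x _ _ S => ?_⟩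
      have := hv₂ (x ++ [a]) (by simp) (fun α' b hb => ⟨x, by
        obtain rfl : a = b := by simpa using (List.append_inj' hb rfl).2
        rfl⟩) S
      simpa using this
    | nonterminal D =>
      obtain ⟨v₁', h₁', hv₁⟩ := hn D v₁ h₁
      refine ⟨v₁' ++ v₂', ?_, ?_, fun x hx₀ hx S => ?_⟩
      · rw [List.map_append]
        exact DerivesWithin.append (s := [nonterminal D]) h₁' h₂'
      · simp only [List.append_eq_nil_iff, hv₁.1, he]
      have hs := hop.isOperatorForm hr
      rw [ho] at hs
      have hl : LeftContext M G D (x.map (terminal (N := G'.NT))) := by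
        rcases hs.ends_terminal with rfl | ⟨α', a, rfl⟩
        · exact .inl (by simp [hx₀ rfl])
        · obtain ⟨x', rfl⟩ := hx α' a rfl
          rw [List.map_append]
          exact .of_output hG hr (by simpa using ho) _
      have hy : RightContext M G D (v₂.map (terminal (N := G'.NT))) := by
        rcases hs.starts_terminal with rfl | ⟨b, s', rfl⟩
        · exact .inl (by simpa using h₂.eq_nil)
        · obtain ⟨t, rfl, -⟩ := h₂.terminal_cons_word
          exact .of_output hG hr ho _
      -- First the yield of D is exchanged while the rest is unchanged; then the inductive
      -- hypothesis is used after the prefix `x ++ v₁'`.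
      have h₃ : G'.Derives [nonterminal S] ((x ++ (v₁ ++ v₂)).map terminal) ↔
          G'.Derives [nonterminal S] ((x ++ (v₁' ++ v₂)).map terminal) := by
        simp only [List.map_append]
        exact ⟨hv₁.replace hG hop hop' hG' hM h₁ hl hy,
          hv₁.symm.replace hG hop hop' hG' hM h₁' hl hy⟩
      have := hv₂ (x ++ v₁') (by simp) (fun α' b hb => by
        simpa using (List.append_inj' hb rfl).2) S
      simp only [List.append_assoc] at this
      exact h₃.trans this

/-- Every type of words derived from a nonterminal is the type of a word with a derivation tree of
bounded height. -/
theorem exists_sameType_bounded {n b : ℕ} {A : G.NT} {w : List T}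
    (h : DerivesWithin G n [nonterminal A] (w.map terminal))
    (hb : G.rules.card * (2 * 2 ^ G'.rules.card) ≤ b) :
    ∃ w', DerivesWithin G b [nonterminal A] (w'.map terminal) ∧ SameType G' w w' := by
  classical
  -- The type of a word as an element of a finite set: a truth value and a set of left-hand sides of
  -- rules, which accounts for the factors `2` and `2 ^ G'.rules.card` of the bound.
  let τ : List T → Prop × Finset G'.NT := fun w => (w = [],
    (G'.rules.image ContextFreeRule.input).filter
      fun B => G'.Derives [nonterminal B] (w.map terminal))
  have hτ : ∀ u v, τ u = τ v ↔ SameType G' u v := by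
    intro u v
    simp only [τ, Prod.mk.injEq, SameType, eq_iff_iff, Finset.ext_iff, Finset.mem_filter,
      Finset.mem_image]
    refine and_congr_right fun _ => forall_congr' fun B => ⟨fun h => ⟨fun hu => ?_, fun hv => ?_⟩,
      fun h => and_congr_right fun _ => h⟩
    · exact (h.1 ⟨exists_input_of_derives_word hu, hu⟩).2
    · exact (h.2 ⟨exists_input_of_derives_word hv, hv⟩).2
  let U : ℕ → Set (G.NT × Prop × Finset G'.NT) := fun n =>
    {p | ∃ w, DerivesWithin G n [nonterminal p.1] (w.map terminal) ∧ τ w = p.2}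
  have key := subset_of_stabilises (U := U) (b := b)
    (F := G.rules.image ContextFreeRule.input ×ˢ Finset.univ ×ˢ
      (G'.rules.image ContextFreeRule.input).powerset)
    (fun m n hmn p ⟨w, hw, hp⟩ => ⟨w, hw.mono hmn, hp⟩) ?_ ?_ ?_ n
  · obtain ⟨w', hw', ht⟩ := key (a := (A, τ w)) ⟨w, h, rfl⟩
    exact ⟨w', hw', (hτ w w').1 ht.symm⟩
  · rintro n ⟨A, p⟩ ⟨w, hA, rfl⟩
    refine Finset.mem_coe.2 (Finset.mem_product.2 ⟨Finset.mem_image.2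
      (exists_input_of_derives_word hA.derives), Finset.mem_product.2 ⟨Finset.mem_univ _, ?_⟩⟩)
    exact Finset.mem_powerset.2 (Finset.filter_subset _ _)
  -- If height n + 1 gives no new type, the children's yields in a tree of height n + 2 can be
  -- exchanged for yields of height n, without altering the type at the root.
  · rintro n hn ⟨A, p⟩ ⟨w, hA, rfl⟩
    obtain ⟨m, hm, r, hr, hA, h⟩ := derivesWithin_word_iff.1 hA
    obtain rfl : m = n + 1 := by omega
    obtain ⟨v, hv, he, ht⟩ := exists_sameType_of_output hG hop hop' hG' hM (n := n) (r := r)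
      (α := []) (fun A w hw => by
        obtain ⟨w', hw', ht⟩ := hn (a := (A, τ w)) ⟨w, hw, rfl⟩
        exact ⟨w', hw', (hτ w w').1 ht.symm⟩) hr rfl h
    exact ⟨v, derivesWithin_word_iff.2 ⟨n, rfl, r, hr, hA, hv⟩,
      (hτ v w).2 (SameType.symm ⟨he, ht [] (fun _ => rfl) (by simp)⟩)⟩
  · refine le_trans ?_ hb
    rw [Finset.card_product, Finset.card_product, Finset.card_powerset, Finset.card_univ,
      Fintype.card_prop]
    gcongr
    · exact Finset.card_image_le
    · norm_num
    · exact Finset.card_image_le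

end Bounds

/-! ### The primitive recursive inclusion test -/

section Algorithm

/-- The words obtained from a right-hand side by replacing each nonterminal by one of the words
that the table `W` lists for it. -/
def substitutions (W : List (ℕ × List ℕ)) (s : List (ℕ ⊕ ℕ)) : List (List ℕ) :=
  s.foldr (fun X vs => Sum.elim (fun a => vs.map fun v => a :: v)
    (fun A => W.flatMap fun p => if p.1 = A then vs.map fun v => p.2 ++ v else []) X) [[]]

/-- The table of the nonterminals with the words that have a derivation tree of height at
most `n`. -/
def wordTable (c : GrammarCode) (n : ℕ) : List (ℕ × List ℕ) :=
  n.rec [] fun _ W => c.2.flatMap fun r => (substitutions W r.2).map fun v => (r.1, v)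

theorem primrec_substitutions : Primrec₂ substitutions := by
  unfold substitutions
  refine Primrec.list_foldr (h := fun (q : List (ℕ × List ℕ) × List (ℕ ⊕ ℕ))
    (x : (ℕ ⊕ ℕ) × List (List ℕ)) => Sum.elim (fun a => x.2.map fun v => a :: v)
    (fun A => q.1.flatMap fun p => if p.1 = A then x.2.map fun v => p.2 ++ v else []) x.1)
    Primrec.snd (Primrec.const [[]]) ?_
  have h := Primrec.sumCasesOn (α := (List (ℕ × List ℕ) × List (ℕ ⊕ ℕ)) × ((ℕ ⊕ ℕ) × List (List ℕ)))
    (f := fun z => z.2.1) (g := fun z a => z.2.2.map fun v => a :: v)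
    (h := fun z A => z.1.1.flatMap fun p => if p.1 = A then z.2.2.map fun v => p.2 ++ v else [])
    (Primrec.fst.comp Primrec.snd) ?_ ?_
  · refine Primrec.of_eq h fun z => ?_
    obtain ⟨_, a | A, _⟩ := z <;> rfl
  · exact Primrec.list_map (Primrec.snd.comp (Primrec.snd.comp Primrec.fst))
      (Primrec.list_cons.comp (Primrec.snd.comp Primrec.fst) Primrec.snd)
  · refine Primrec.list_flatMap (Primrec.fst.comp (Primrec.fst.comp Primrec.fst))
      (Primrec.ite ?_ ?_ (Primrec.const []))
    · exact Primrec.eq.comp (Primrec.fst.comp Primrec.snd) (Primrec.snd.comp Primrec.fst)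
    · exact Primrec.list_map
        (Primrec.snd.comp (Primrec.snd.comp (Primrec.fst.comp Primrec.fst)))
        (Primrec.list_append.comp (Primrec.snd.comp (Primrec.snd.comp Primrec.fst)) Primrec.snd)

theorem primrec_wordTable : Primrec₂ wordTable := by
  unfold wordTable
  refine Primrec.nat_rec' (g := fun _ => []) (h := fun (q : GrammarCode × ℕ)
    (x : ℕ × List (ℕ × List ℕ)) =>
      q.1.2.flatMap fun r => (substitutions x.2 r.2).map fun v => (r.1, v))
    Primrec.snd (Primrec.const []) ?_
  refine Primrec.list_flatMap (Primrec.snd.comp (Primrec.fst.comp Primrec.fst))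
    (Primrec.list_map ?_ ?_)
  · exact primrec_substitutions.comp (Primrec.snd.comp (Primrec.snd.comp Primrec.fst))
      (Primrec.snd.comp Primrec.snd)
  · exact Primrec.pair (Primrec.fst.comp (Primrec.snd.comp Primrec.fst)) Primrec.snd

/-- Every word of bounded derivation height of the first grammar has a derivation tree of bounded
height in the second grammar. -/
def InclusionTest (p : GrammarCode × GrammarCode) : Prop :=
  ∀ q ∈ wordTable p.1 (p.1.2.length * (2 * 2 ^ p.2.2.length)), q.1 ≠ p.1.1 ∨
    ∃ q' ∈ wordTable p.2 (p.2.2.length * 2 ^ q.2.length), q' = (p.2.1, q.2)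

theorem primrec_pow : Primrec₂ ((· ^ ·) : ℕ → ℕ → ℕ) :=
  Primrec₂.unpaired'.1 Nat.Primrec.pow

theorem primrecPred_inclusionTest : PrimrecPred InclusionTest := by
  have len : ∀ {α : Type} [Primcodable α] {f : α → GrammarCode}, Primrec f →
      Primrec fun a => (f a).2.length :=
    fun hf => Primrec.list_length.comp (Primrec.snd.comp hf)
  have pow2 : ∀ {α : Type} [Primcodable α] {f : α → ℕ}, Primrec f →
      Primrec fun a => 2 ^ f a :=
    fun hf => primrec_pow.comp (Primrec.const 2) hf
  have hR : PrimrecRel fun (q : ℕ × List ℕ) (p : GrammarCode × GrammarCode) => q.1 ≠ p.1.1 ∨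
      ∃ q' ∈ wordTable p.2 (p.2.2.length * 2 ^ q.2.length), q' = (p.2.1, q.2) := by
    refine PrimrecPred.or (PrimrecPred.not ?_) ?_
    · exact Primrec.eq.comp (Primrec.fst.comp Primrec.fst)
        (Primrec.fst.comp (Primrec.fst.comp Primrec.snd))
    · refine (PrimrecRel.exists_mem_list Primrec.eq).comp (primrec_wordTable.comp
        (Primrec.snd.comp Primrec.snd) (Primrec.nat_mul.comp
          (len (Primrec.snd.comp Primrec.snd)) (pow2 ?_))) ?_
      · exact Primrec.list_length.comp (Primrec.snd.comp Primrec.fst)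
      · exact Primrec.pair (Primrec.fst.comp (Primrec.snd.comp Primrec.snd))
          (Primrec.snd.comp Primrec.fst)
  exact hR.forall_mem_list.comp (primrec_wordTable.comp Primrec.fst
    (Primrec.nat_mul.comp (len Primrec.fst) (Primrec.nat_mul.comp (Primrec.const 2)
      (pow2 (len Primrec.snd))))) Primrec.id

theorem mem_substitutions_iff {c : GrammarCode} {n : ℕ} {W : List (ℕ × List ℕ)}
    (hW : ∀ (A : ℕ) (w : List ℕ), (A, w) ∈ W ↔
      DerivesWithin c.grammar n [nonterminal A] (w.map terminal))
    (s : List (ℕ ⊕ ℕ)) (v : List ℕ) :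
    v ∈ substitutions W s ↔
      DerivesWithin c.grammar n (s.map decodeSymbol) (v.map terminal) := by
  induction s generalizing v with
  | nil =>
    refine ⟨fun h => ?_, fun h => ?_⟩
    · obtain rfl : v = [] := by simpa [substitutions] using h
      exact .nil n
    · obtain rfl : v = [] := by simpa using h.eq_nil
      simp [substitutions]
  | cons X s ih =>
    cases X with
    | inl a =>
      have h₁ : v ∈ substitutions W (Sum.inl a :: s) ↔ ∃ u ∈ substitutions W s, a :: u = v :=
        List.mem_map
      rw [h₁]
      constructor
      · rintro ⟨u, hu, rfl⟩
        exact .keep _ ((ih u).1 hu)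
      · intro h
        obtain ⟨u, rfl, hu⟩ := DerivesWithin.terminal_cons_word (G := c.grammar) h
        exact ⟨u, (ih u).2 hu, rfl⟩
    | inr A =>
      have h₁ : v ∈ substitutions W (Sum.inr A :: s) ↔
          ∃ p ∈ W, v ∈ if p.1 = A then (substitutions W s).map fun v => p.2 ++ v else [] :=
        List.mem_flatMap
      rw [h₁]
      constructor
      · rintro ⟨⟨B, w⟩, hp, hv⟩
        split_ifs at hv with hB
        · obtain rfl : B = A := hB
          obtain ⟨u, hu, rfl⟩ := List.mem_map.1 hv
          rw [List.map_append]
          exact DerivesWithin.append (s := [nonterminal B]) ((hW B w).1 hp) ((ih u).1 hu)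
        · simp at hv
      · intro h
        obtain ⟨w, u, rfl, hw, hu⟩ := DerivesWithin.split_append_word (G := c.grammar)
          (s := [nonterminal A]) (s' := s.map decodeSymbol) h
        refine ⟨(A, w), (hW A w).2 hw, ?_⟩
        rw [if_pos rfl]
        exact List.mem_map.2 ⟨u, (ih u).2 hu, rfl⟩

theorem GrammarCode.card_rules_le (c : GrammarCode) : c.grammar.rules.card ≤ c.2.length :=
  (List.toFinset_card_le (c.2.map decodeRule)).trans (List.length_map _).le

theorem GrammarCode.mem_rules_iff {c : GrammarCode} {r : ContextFreeRule ℕ ℕ} :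
    r ∈ c.grammar.rules ↔ ∃ x ∈ c.2, decodeRule x = r :=
  (List.mem_toFinset (l := c.2.map decodeRule)).trans List.mem_map

theorem mem_wordTable_iff (c : GrammarCode) (n A : ℕ) (w : List ℕ) :
    (A, w) ∈ wordTable c n ↔
      DerivesWithin c.grammar n [nonterminal A] (w.map terminal) := by
  induction n generalizing A w with
  | zero =>
    refine ⟨fun h => by simp [wordTable] at h, fun h => ?_⟩
    obtain ⟨m, hm, -⟩ := (derivesWithin_word_iff (G := c.grammar)).1 h
    omega
  | succ n ih =>
    have h₁ : (A, w) ∈ wordTable c (n + 1) ↔ ∃ r ∈ c.2, (A, w) ∈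
        (substitutions (wordTable c n) r.2).map fun v => (r.1, v) := List.mem_flatMap
    refine h₁.trans (Iff.trans ?_ (derivesWithin_word_iff (G := c.grammar) (A := A)).symm)
    constructor
    · rintro ⟨r, hr, h⟩
      obtain ⟨v, hv, h⟩ := List.mem_map.1 h
      obtain ⟨rfl, rfl⟩ : r.1 = A ∧ v = w := by simpa using h
      exact ⟨n, rfl, decodeRule r, GrammarCode.mem_rules_iff.2 ⟨r, hr, rfl⟩, rfl,
        (mem_substitutions_iff ih r.2 v).1 hv⟩
    · rintro ⟨m, hm, r, hr, hA, h⟩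
      obtain rfl : n = m := by omega
      obtain ⟨x, hx, rfl⟩ := GrammarCode.mem_rules_iff.1 hr
      obtain rfl : x.1 = A := hA
      exact ⟨x, hx, List.mem_map.2 ⟨w, (mem_substitutions_iff ih x.2 w).2 h, rfl⟩⟩

/-- Any word of the first language shares its type with a word in the finite table; the type records
derivability from the second axiom, so the tested word decides for the other. -/
theorem inclusionTest_iff {c₁ c₂ : GrammarCode} (h₁ : IsOPG c₁.grammar) (h₂ : IsOPG c₂.grammar)
    (h : (opm c₁.grammar).Compatible (opm c₂.grammar)) :
    InclusionTest (c₁, c₂) ↔ c₁.grammar.language ≤ c₂.grammar.language := by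
  constructor
  · intro ht w hw
    obtain ⟨n, hn⟩ := exists_derivesWithin hw
    -- Here `M` is the union of the two matrices, conflict-free by compatibility. Lengths of rule
    -- lists replace numbers of rules, which they bound from above.
    obtain ⟨w', hw', hs⟩ := exists_sameType_bounded (fun _ _ => Set.subset_union_left) h₁.1 h₂.1
      (fun _ _ => Set.subset_union_right) h hn
      (Nat.mul_le_mul c₁.card_rules_le (Nat.mul_le_mul le_rfl
        (Nat.pow_le_pow_right two_pos c₂.card_rules_le)))
    rcases ht (c₁.1, w') ((mem_wordTable_iff ..).2 hw') with h | ⟨q, hq, rfl⟩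
    · exact (h rfl).elim
    · exact (hs.2 c₂.1).2 ((mem_wordTable_iff ..).1 hq).derives
  · rintro hle ⟨A, w⟩ hw
    refine or_iff_not_imp_left.2 fun hA => ⟨_, ?_, rfl⟩
    obtain rfl : A = c₁.1 := not_not.1 hA
    obtain ⟨n, hn⟩ := exists_derivesWithin (hle ((mem_wordTable_iff ..).1 hw).derives)
    exact (mem_wordTable_iff ..).2 (hn.of_word_bound (Nat.mul_le_mul_right _ c₂.card_rules_le))

end Algorithm

end OperatorPrecedence

theorem mainTheorem3 :
    ∃ decider : OperatorPrecedence.GrammarCode × OperatorPrecedence.GrammarCode → Bool,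
      Computable decider ∧
      ∀ c₁ c₂ : OperatorPrecedence.GrammarCode,
        OperatorPrecedence.IsOPG c₁.grammar →
        OperatorPrecedence.IsOPG c₂.grammar →
        (OperatorPrecedence.opm c₁.grammar).Compatible (OperatorPrecedence.opm c₂.grammar) →
        (decider (c₁, c₂) = true ↔ c₁.grammar.language ≤ c₂.grammar.language) := by
  classical
  refine ⟨fun p => decide (OperatorPrecedence.InclusionTest p),
    OperatorPrecedence.primrecPred_inclusionTest.decide.to_comp, fun c₁ c₂ h₁ h₂ h => ?_⟩
  rw [decide_eq_true_iff]
  exact OperatorPrecedence.inclusionTest_iff h₁ h₂ h
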